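/- Let $A\in\mathbb{R}^{n\times n}$ have no eigenvalue with positive real part, let $\mathcal{G}$ be a digraph on the agents $0,1,\dots,N$, where $0$ is the leader and $1,\dots,N$ are the followers, and let $a_{ij}=1$ if agent $i$ receives information from agent $j$ (there is an edge from $j$ to $i$) and $a_{ij}=0$ otherwise. Assume that $\mathcal{G}$ contains a directed spanning tree rooted at the leader, i.e. there is a directed path from $0$ to every agent. For each edge from $j$ to $i$ let $\tau_{ij}:[0,\infty)\to[0,\bar\tau]$ be the (known, heterogeneous, time-varying, bounded) communication delay from $j$ to $i$, and let $\epsilon>0$ be arbitrary. Let the leader satisfy $\dot x_0(t)=Ax_0(t)$ for $t\in\mathbb{R}$, and let the observers $\xi_i(t)\in\mathbb{R}^n$, $i=1,\dots,N$, satisfy $\xi_i(t)=0$ for $t\le 0$ and $$\dot\xi_i(t)=A\xi_i(t)+\epsilon\sum_{j=1,\,j\ne i}^{N}a_{ij}\bigl[e^{A\tau_{ij}(t)}\xi_j(t-\tau_{ij}(t))-\xi_i(t)\bigr]+\epsilon a_{i0}\bigl[e^{A\tau_{i0}(t)}x_0(t-\tau_{i0}(t))-\xi_i(t)\bigr],\qquad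 t\ge 0,$$ in the Carathéodory sense ($\xi_i$ is continuous and is the integral of the right-hand side). Then every observer error $\xi_i-x_0$ tends to zero exponentially: there are constants $C,\beta>0$, independent of the initial state $x_0(0)$, such that $$\|\xi_i(t)-x_0(t)\|\le C e^{-\beta t}\|x_0(0)\|\qquad\text{for all } t\ge 0,\ i=1,\dots,N.$$ -/

import Mathlib

open scoped Matrix

/-- In the communication digraph on the agents `0, 1, …, N` (with `0` the leader), `G.Adj j i` means
that agent `i` receives information from agent `j`. The weight `a_{ij}` is then `1`, and it is `0`
if there is no such edge. -/
noncomputable def weight {N : ℕ} (G : Digraph (Fin (N + 1))) (i j : Fin (N + 1)) : ℝ :=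
  open Classical in if G.Adj j i then 1 else 0

/-- `G` contains a directed spanning tree with root `r`: there is a directed path from `r` to
every node. -/
def HasSpanningTreeRootedAt {N : ℕ} (G : Digraph (Fin (N + 1))) (r : Fin (N + 1)) : Prop :=
  ∀ v, Relation.ReflTransGen G.Adj r v

/-- No (complex) eigenvalue of the real matrix `A` has positive real part. -/
def NoEigenvalueWithPosRe {n : ℕ} (A : Matrix (Fin n) (Fin n) ℝ) : Prop :=
  ∀ μ : ℂ, Module.End.HasEigenvalue (Matrix.toLin' (A.map ((↑) : ℝ → ℂ))) μ → μ.re ≤ 0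

/-- The leader dynamics `x₀' = A x₀`. -/
def IsLeaderTrajectory {n : ℕ} (A : Matrix (Fin n) (Fin n) ℝ) (x₀ : ℝ → Fin n → ℝ) : Prop :=
  ∀ t, HasDerivAt x₀ (A *ᵥ x₀ t) t

/-- The right-hand side of the observer of follower `i` at time `t`. Follower `i : Fin N` is the
agent `i.succ`; `τ i j` is the communication delay from agent `j` to agent `i`. -/
noncomputable def observerField {N n : ℕ} (A : Matrix (Fin n) (Fin n) ℝ)
    (G : Digraph (Fin (N + 1))) (ε : ℝ) (τ : Fin (N + 1) → Fin (N + 1) → ℝ → ℝ)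
    (x₀ : ℝ → Fin n → ℝ) (ξ : Fin N → ℝ → Fin n → ℝ) (i : Fin N) (t : ℝ) : Fin n → ℝ :=
  A *ᵥ ξ i t
    + ε • ∑ j ∈ Finset.univ.erase i, weight G i.succ j.succ •
        (NormedSpace.exp (τ i.succ j.succ t • A) *ᵥ ξ j (t - τ i.succ j.succ t) - ξ i t)
    + (ε * weight G i.succ 0) •
        (NormedSpace.exp (τ i.succ 0 t • A) *ᵥ x₀ (t - τ i.succ 0 t) - ξ i t)

/-- `ξ` is a (Carathéodory) solution of the observer equations `ξ_i' = observerField … i` on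
`[0, ∞)` with `ξ_i(t) = 0` for `t ≤ 0`: each `ξ_i` is continuous and is the integral of the
right-hand side, i.e. it is locally absolutely continuous and the equation holds for almost every
`t ≥ 0`. Classical solutions are included. -/
structure IsObserverTrajectory {N n : ℕ} (A : Matrix (Fin n) (Fin n) ℝ)
    (G : Digraph (Fin (N + 1))) (ε : ℝ) (τ : Fin (N + 1) → Fin (N + 1) → ℝ → ℝ)
    (x₀ : ℝ → Fin n → ℝ) (ξ : Fin N → ℝ → Fin n → ℝ) : Prop where
  continuous : ∀ i, Continuous (ξ i)
  eq_zero : ∀ i, ∀ t ≤ 0, ξ i t = 0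
  integrable : ∀ i, ∀ t ≥ 0,
    IntervalIntegrable (observerField A G ε τ x₀ ξ i) MeasureTheory.volume 0 t
  eq_integral : ∀ i, ∀ t ≥ 0, ξ i t = ∫ s in (0 : ℝ)..t, observerField A G ε τ x₀ ξ i s

/-
In the coordinates `z_i(t) = e^{-tA} (ξ_i(t) - x₀(t))`, which move with the leader, the factors
`e^{Aτ}` cancel and the errors solve a delayed consensus equation whose root, the leader, is pinned
at `0`. Since every agent is reachable from the root, `p_i = 2 - δ ^ depth(i)` is, for small `δ`,
strictly superharmonic off the root, and this strictness absorbs the bounded delays and a small rate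
`β`: at a point where `‖z_i(t)‖ e^{βt} / p_i` is maximal and exceeds its bound at negative times,
the variation of constants formula puts it strictly below this maximum. Hence `z_i` decays at the
rate `β`. As no eigenvalue of `A` has positive real part, `e^{tA}` grows more slowly than
`e^{βt/2}`, and undoing the change of coordinates costs only half of the rate.
-/

open Filter MeasureTheory Module.End Relation Set Topology

theorem exp_apply_eq_sum_of_pow_apply_eq_zero {𝕜 E : Type*} [RCLike 𝕜] [NormedAddCommGroup E]
    [NormedSpace 𝕜 E] [CompleteSpace E] {f : E →L[𝕜] E} {v : E} {k : ℕ} (hv : (f ^ k) v = 0) :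
    NormedSpace.exp f v = ∑ j ∈ Finset.range k, ((j.factorial : 𝕜)⁻¹) • (f ^ j) v := by
  have hsum := (ContinuousLinearMap.apply 𝕜 E v).hasSum
    (NormedSpace.exp_series_hasSum_exp' (𝕂 := 𝕜) f)
  refine hsum.unique (hasSum_sum_of_ne_finset_zero fun j hj => ?_)
  obtain ⟨l, rfl⟩ := Nat.exists_eq_add_of_le' (not_lt.1 (mt Finset.mem_range.2 hj))
  simp [pow_add, hv]

theorem norm_exp_smul_apply_le_of_pow_apply_eq_zero {𝕜 E : Type*} [RCLike 𝕜]
    [NormedAddCommGroup E] [NormedSpace 𝕜 E] [CompleteSpace E] {f : E →L[𝕜] E} {v : E} {k : ℕ}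
    (hv : (f ^ k) v = 0) {c t : ℝ} (hc : 0 < c) (ht : 0 ≤ t) :
    ‖NormedSpace.exp ((t : 𝕜) • f) v‖ ≤
      (∑ j ∈ Finset.range k, ‖(f ^ j) v‖ / c ^ j) * Real.exp (c * t) := by
  have hv' : (((t : 𝕜) • f) ^ k) v = 0 := by
    rw [smul_pow, smul_apply, hv, smul_zero]
  rw [exp_apply_eq_sum_of_pow_apply_eq_zero hv', Finset.sum_mul]
  refine (norm_sum_le _ _).trans (Finset.sum_le_sum fun j _ => ?_)
  calc ‖((j.factorial : 𝕜)⁻¹) • (((t : 𝕜) • f) ^ j) v‖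
      = ‖(f ^ j) v‖ / c ^ j * ((c * t) ^ j / j.factorial) := by
        rw [smul_pow, smul_apply, norm_smul, norm_smul, norm_inv, norm_pow,
          RCLike.norm_natCast, RCLike.norm_of_nonneg ht, mul_pow]
        field_simp
    _ ≤ ‖(f ^ j) v‖ / c ^ j * Real.exp (c * t) := by
        gcongr
        exact Real.pow_div_factorial_le_exp _ (by positivity) j

theorem exp_eq_exp_smul_exp_sub {𝕜 𝔸 : Type*} [RCLike 𝕜] [NormedRing 𝔸] [NormedAlgebra 𝕜 𝔸]
    [CompleteSpace 𝔸] (a : 𝔸) (μ : 𝕜) :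
    NormedSpace.exp a = NormedSpace.exp μ • NormedSpace.exp (a - μ • 1) := by
  let _ : NormedAlgebra ℚ 𝔸 := .restrictScalars ℚ 𝕜 𝔸
  have hsplit : a = algebraMap 𝕜 𝔸 μ + (a - μ • 1) := by
    rw [Algebra.algebraMap_eq_smul_one, add_sub_cancel]
  conv_lhs => rw [hsplit, NormedSpace.exp_add_of_commute (Algebra.commutes _ _),
    ← NormedSpace.algebraMap_exp_comm, Algebra.algebraMap_eq_smul_one, smul_one_mul]

section ComplexEndomorphism

variable {E : Type*} [NormedAddCommGroup E] [NormedSpace ℂ E]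

theorem exists_norm_exp_smul_apply_le_of_mem_maxGenEigenspace [CompleteSpace E] {f : E →L[ℂ] E}
    {μ : ℂ} {v : E} (hv : v ∈ maxGenEigenspace (f : E →ₗ[ℂ] E) μ) {b : ℝ} (hμ : μ.re < b) :
    ∃ K : ℝ, ∀ t : ℝ, 0 ≤ t →
      ‖NormedSpace.exp ((t : ℂ) • f) v‖ ≤ K * Real.exp (b * t) := by
  obtain ⟨k, hk⟩ := (mem_maxGenEigenspace _ _ _).1 hv
  have hk' : ((f - μ • 1) ^ k) v = 0 := by
    rw [← hk, ← ContinuousLinearMap.coe_coe, ContinuousLinearMap.toLinearMap_pow]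
    rfl
  refine ⟨∑ j ∈ Finset.range k, ‖((f - μ • 1) ^ j) v‖ / (b - μ.re) ^ j, fun t ht => ?_⟩
  set K := ∑ j ∈ Finset.range k, ‖((f - μ • 1) ^ j) v‖ / (b - μ.re) ^ j
  calc ‖NormedSpace.exp ((t : ℂ) • f) v‖
      = Real.exp (μ.re * t) * ‖NormedSpace.exp ((t : ℂ) • (f - μ • 1)) v‖ := by
        rw [exp_eq_exp_smul_exp_sub ((t : ℂ) • f) (t * μ), mul_smul, ← smul_sub, smul_apply,
          norm_smul, ← Complex.exp_eq_exp_ℂ, Complex.norm_exp, Complex.re_ofReal_mul, mul_comm t]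
    _ ≤ Real.exp (μ.re * t) * (K * Real.exp ((b - μ.re) * t)) := by
        gcongr
        exact norm_exp_smul_apply_le_of_pow_apply_eq_zero hk' (sub_pos.2 hμ) ht
    _ = K * Real.exp (b * t) := by
        rw [mul_left_comm, ← Real.exp_add]
        ring_nf

theorem exists_norm_exp_smul_apply_le [FiniteDimensional ℂ E] {f : E →L[ℂ] E} {b : ℝ}
    (hf : ∀ μ, HasEigenvalue (f : E →ₗ[ℂ] E) μ → μ.re < b) (v : E) :
    ∃ K : ℝ, ∀ t : ℝ, 0 ≤ t →
      ‖NormedSpace.exp ((t : ℂ) • f) v‖ ≤ K * Real.exp (b * t) := by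
  have : CompleteSpace E := FiniteDimensional.complete ℂ E
  have hv : v ∈ ⨆ μ, maxGenEigenspace (f : E →ₗ[ℂ] E) μ := by
    rw [iSup_maxGenEigenspace_eq_top]
    exact Submodule.mem_top
  induction hv using Submodule.iSup_induction' with
  | mem μ v hv =>
    rcases eq_or_ne v 0 with rfl | hv0
    · exact ⟨0, fun t _ => by simp⟩
    · have hμ : HasEigenvalue (f : E →ₗ[ℂ] E) μ :=
        HasUnifEigenvalue.lt (k := ⊤) zero_lt_one ((Submodule.ne_bot_iff _).2 ⟨v, hv, hv0⟩)
      exact exists_norm_exp_smul_apply_le_of_mem_maxGenEigenspace hv (hf μ hμ)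
  | zero => exact ⟨0, fun t _ => by simp⟩
  | add v w _ _ hv hw =>
    obtain ⟨K, hK⟩ := hv
    obtain ⟨L, hL⟩ := hw
    refine ⟨K + L, fun t ht => ?_⟩
    rw [map_add, add_mul]
    exact norm_add_le_of_le (hK t ht) (hL t ht)

theorem exists_norm_exp_smul_le [FiniteDimensional ℂ E] {f : E →L[ℂ] E} {b : ℝ}
    (hf : ∀ μ, HasEigenvalue (f : E →ₗ[ℂ] E) μ → μ.re < b) :
    ∃ K : ℝ, ∀ t : ℝ, 0 ≤ t → ‖NormedSpace.exp ((t : ℂ) • f)‖ ≤ K * Real.exp (b * t) := by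
  have : CompleteSpace E := FiniteDimensional.complete ℂ E
  have hnorm : ∀ (t : ℝ) (v : E), ‖((Real.exp (b * t) : ℂ)⁻¹ • NormedSpace.exp ((t : ℂ) • f)) v‖ =
      ‖NormedSpace.exp ((t : ℂ) • f) v‖ / Real.exp (b * t) := fun t v => by
    rw [smul_apply, norm_smul, norm_inv,
      Complex.norm_of_nonneg (Real.exp_pos _).le, div_eq_inv_mul]
  obtain ⟨K, hK⟩ := banach_steinhaus (σ₁₂ := RingHom.id ℂ) (ι := Set.Ici (0 : ℝ))
    (g := fun t => (Real.exp (b * t) : ℂ)⁻¹ • NormedSpace.exp ((t : ℂ) • f)) fun v => by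
      obtain ⟨K, hK⟩ := exists_norm_exp_smul_apply_le hf v
      refine ⟨K, fun t => ?_⟩
      rw [hnorm, div_le_iff₀ (Real.exp_pos _)]
      exact hK t t.2
  refine ⟨K, fun t ht => ?_⟩
  have h := hK ⟨t, ht⟩
  rwa [norm_smul, norm_inv, Complex.norm_of_nonneg (Real.exp_pos _).le,
    inv_mul_le_iff₀ (Real.exp_pos _), mul_comm] at h

end ComplexEndomorphism

section RealMatrix

open scoped Matrix.Norms.L2Operator

theorem toEuclideanCLM_exp {𝕜 ι : Type*} [RCLike 𝕜] [Fintype ι] [DecidableEq ι]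
    (M : Matrix ι ι 𝕜) :
    Matrix.toEuclideanCLM (n := ι) (𝕜 := 𝕜) (NormedSpace.exp M) =
      NormedSpace.exp (Matrix.toEuclideanCLM (n := ι) (𝕜 := 𝕜) M) := by
  let _ : NormedAlgebra ℚ (Matrix ι ι 𝕜) := .restrictScalars ℚ 𝕜 _
  exact NormedSpace.map_exp (Matrix.toEuclideanCLM (n := ι) (𝕜 := 𝕜))
    (LinearMap.continuous_of_finiteDimensional
      (Matrix.toEuclideanCLM (n := ι) (𝕜 := 𝕜)).toAlgEquiv.toLinearMap) M

theorem map_ofReal_exp {ι : Type*} [Fintype ι] [DecidableEq ι] (A : Matrix ι ι ℝ) :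
    (NormedSpace.exp A).map Complex.ofReal = NormedSpace.exp (A.map Complex.ofReal) := by
  let _ : NormedAlgebra ℚ (Matrix ι ι ℝ) := .restrictScalars ℚ ℝ _
  exact NormedSpace.map_exp (Complex.ofRealHom.mapMatrix (m := ι))
    (continuous_id.matrix_map Complex.continuous_ofReal) A

theorem norm_le_norm_map_ofReal {ι : Type*} [Fintype ι] [DecidableEq ι] (A : Matrix ι ι ℝ) :
    ‖A‖ ≤ ‖A.map Complex.ofReal‖ := by
  have hnorm : ∀ v : ι → ℝ,
      ‖WithLp.toLp 2 (fun k => (v k : ℂ))‖ = ‖WithLp.toLp 2 v‖ := fun v => by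
    simp [EuclideanSpace.norm_eq]
  rw [← Matrix.l2_opNorm_toEuclideanCLM]
  refine ContinuousLinearMap.opNorm_le_bound _ (norm_nonneg _) fun v => ?_
  have hmap : A.map Complex.ofReal *ᵥ (fun k => (v k : ℂ)) = fun k => (((A *ᵥ v) k : ℝ) : ℂ) :=
    (funext (Complex.ofRealHom.map_mulVec A v)).symm
  have h := Matrix.l2_opNorm_mulVec (A.map Complex.ofReal) (WithLp.toLp 2 fun k => (v k : ℂ))
  rw [hmap, hnorm] at h
  exact (hnorm _).symm.trans_le h

theorem NoEigenvalueWithPosRe.exists_norm_exp_smul_le {n : ℕ} {A : Matrix (Fin n) (Fin n) ℝ}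
    (hA : NoEigenvalueWithPosRe A) {b : ℝ} (hb : 0 < b) :
    ∃ K : ℝ, ∀ t : ℝ, 0 ≤ t →
      ‖NormedSpace.exp (t • Matrix.toEuclideanCLM (n := Fin n) (𝕜 := ℝ) A)‖ ≤
        K * Real.exp (b * t) := by
  have hspec : ∀ μ : ℂ, HasEigenvalue
      (Matrix.toEuclideanCLM (n := Fin n) (𝕜 := ℂ) (A.map Complex.ofReal)).toLinearMap μ →
        μ.re < b := fun μ hμ => by
    refine (hA μ ?_).trans_lt hb
    rwa [hasEigenvalue_iff_mem_spectrum, Matrix.coe_toEuclideanCLM_eq_toEuclideanLin,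
      Matrix.spectrum_toLpLin, ← Matrix.spectrum_toLin', ← hasEigenvalue_iff_mem_spectrum]
      at hμ
  obtain ⟨K, hK⟩ := _root_.exists_norm_exp_smul_le hspec
  refine ⟨K, fun t ht => le_trans ?_ (hK t ht)⟩
  have hmap : (t • A).map Complex.ofReal = (t : ℂ) • A.map Complex.ofReal := by
    ext; simp
  rw [← map_smul, ← map_smul, ← toEuclideanCLM_exp, ← toEuclideanCLM_exp,
    Matrix.l2_opNorm_toEuclideanCLM, Matrix.l2_opNorm_toEuclideanCLM, ← hmap, ← map_ofReal_exp]
  exact norm_le_norm_map_ofReal _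

end RealMatrix

theorem absolutelyContinuousOnInterval_of_dist_le {X Y Z : Type*} [PseudoMetricSpace X]
    [PseudoMetricSpace Y] [PseudoMetricSpace Z] {f : ℝ → X} {g : ℝ → Y} {k : ℝ → Z} {a b C D : ℝ}
    (hg : AbsolutelyContinuousOnInterval g a b) (hk : AbsolutelyContinuousOnInterval k a b)
    (hf : ∀ x ∈ uIcc a b, ∀ y ∈ uIcc a b,
      dist (f x) (f y) ≤ C * dist (g x) (g y) + D * dist (k x) (k y)) :
    AbsolutelyContinuousOnInterval f a b := by
  have hlim := (Tendsto.const_mul C hg).add (Tendsto.const_mul D hk)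
  simp only [mul_zero, add_zero] at hlim
  refine squeeze_zero' (.of_forall fun I => Finset.sum_nonneg fun i _ => dist_nonneg)
    (eventually_inf_principal.2 (.of_forall fun I hI => ?_)) hlim
  rw [Finset.mul_sum, Finset.mul_sum, ← Finset.sum_add_distrib]
  exact Finset.sum_le_sum fun i hi => hf _ (hI.1 i hi).1 _ (hI.1 i hi).2

section IntegrationByParts

variable {E F : Type*} [NormedAddCommGroup E] [NormedSpace ℝ E] [NormedAddCommGroup F]
  [NormedSpace ℝ F] {a b : ℝ}

theorem absolutelyContinuousOnInterval_integral {h : ℝ → E} (hh : IntervalIntegrable h volume a b) :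
    AbsolutelyContinuousOnInterval (fun t => ∫ s in a..t, h s) a b := by
  have hnorm := hh.norm.absolutelyContinuousOnInterval_intervalIntegral left_mem_uIcc
  refine absolutelyContinuousOnInterval_of_dist_le (C := 1) (D := 0) hnorm hnorm
    fun x hx y hy => ?_
  have hsub : ∀ z ∈ uIcc a b, IntervalIntegrable h volume a z := fun z hz =>
    hh.mono_set (uIcc_subset_uIcc_left hz)
  rw [one_mul, zero_mul, add_zero, dist_eq_norm, dist_eq_norm,
    intervalIntegral.integral_interval_sub_left (hsub x hx) (hsub y hy),
    intervalIntegral.integral_interval_sub_left (hsub x hx).norm (hsub y hy).norm]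
  exact intervalIntegral.norm_integral_le_abs_integral_norm

theorem absolutelyContinuousOnInterval_clm_apply {V : ℝ → E →L[ℝ] F} {f : ℝ → E}
    (hV : AbsolutelyContinuousOnInterval V a b) (hf : AbsolutelyContinuousOnInterval f a b) :
    AbsolutelyContinuousOnInterval (fun t => V t (f t)) a b := by
  obtain ⟨C, hC⟩ := hV.exists_bound
  obtain ⟨D, hD⟩ := hf.exists_bound
  refine absolutelyContinuousOnInterval_of_dist_le hV hf (C := D) (D := C) fun x hx y hy => ?_
  have hsplit : V x (f x) - V y (f y) = (V x - V y) (f x) + V y (f x - f y) := by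
    simp
  simp only [dist_eq_norm]
  rw [hsplit]
  calc ‖(V x - V y) (f x) + V y (f x - f y)‖
      ≤ ‖V x - V y‖ * ‖f x‖ + ‖V y‖ * ‖f x - f y‖ :=
        norm_add_le_of_le ((V x - V y).le_opNorm _) ((V y).le_opNorm _)
    _ ≤ D * ‖V x - V y‖ + C * ‖f x - f y‖ := by
        rw [mul_comm D]
        gcongr
        exacts [hD x hx, hC y hy]

theorem intervalIntegrable_clm_apply {V : ℝ → E →L[ℝ] F} {h : ℝ → E}
    (hV : ContinuousOn V (uIcc a b)) (hh : IntervalIntegrable h volume a b) :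
    IntervalIntegrable (fun t => V t (h t)) volume a b := by
  obtain ⟨C, hC⟩ := isCompact_uIcc.exists_bound_of_continuousOn hV
  rw [intervalIntegrable_iff] at hh ⊢
  exact (ContinuousLinearMap.id ℝ (E →L[ℝ] F)).integrable_of_bilin_of_bdd_left C
    ((hV.mono uIoc_subset_uIcc).aestronglyMeasurable measurableSet_uIoc)
    ((ae_restrict_iff' measurableSet_uIoc).2
      (.of_forall fun t ht => hC t (uIoc_subset_uIcc ht))) hh

theorem clm_apply_sub_eq_integral_of_hasDerivAt [CompleteSpace E] [CompleteSpace F]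
    {V V' : ℝ → E →L[ℝ] F} {f h : ℝ → E}
    (hV : ∀ t, HasDerivAt V (V' t) t) (hV' : Continuous V') (hh : IntervalIntegrable h volume a b)
    (hf : ∀ t ∈ uIcc a b, f t = f a + ∫ s in a..t, h s) :
    V b (f b) - V a (f a) = ∫ s in a..b, (V' s (f s) + V s (h s)) := by
  have hVdiff : ContDiff ℝ 1 V := by
    rw [contDiff_one_iff_deriv]
    exact ⟨fun t => (hV t).differentiableAt, (funext fun t => (hV t).deriv : deriv V = V') ▸ hV'⟩
  set H : ℝ → E := fun t => f a + ∫ s in a..t, h s with hH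
  have hHac : AbsolutelyContinuousOnInterval H a b :=
    (contDiff_const.contDiffOn.absolutelyContinuousOnInterval (f := fun _ => f a)).add
      (absolutelyContinuousOnInterval_integral hh)
  have hint : IntervalIntegrable (fun s => V' s (H s) + V s (h s)) volume a b :=
    (hV'.continuousOn.clm_apply hHac.continuousOn).intervalIntegrable.add
      (intervalIntegrable_clm_apply hVdiff.continuous.continuousOn hh)
  have hdiffAC := (absolutelyContinuousOnInterval_clm_apply
    hVdiff.contDiffOn.absolutelyContinuousOnInterval hHac).sub
      (absolutelyContinuousOnInterval_integral hint)
  obtain ⟨c, hc⟩ := hdiffAC.const_of_ae_hasDerivAt_zero (by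
    filter_upwards [hh.ae_hasDerivAt_integral, hint.ae_hasDerivAt_integral] with t ht hint_t htmem
    have hHt : HasDerivAt H (h t) t := (ht htmem a left_mem_uIcc).const_add (f a)
    exact (((hV t).clm_apply hHt).sub (hint_t htmem a left_mem_uIcc)).congr_deriv (sub_self _))
  have hend := (hc b right_mem_uIcc).trans (hc a left_mem_uIcc).symm
  have hcongr : ∫ s in a..b, (V' s (f s) + V s (h s)) = ∫ s in a..b, (V' s (H s) + V s (h s)) :=
    intervalIntegral.integral_congr fun t ht => by simp only [hf t ht, hH]
  rw [hcongr, hf b right_mem_uIcc]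
  simp only [Pi.sub_apply, hH, intervalIntegral.integral_same, add_zero, sub_zero] at hend
  rw [← hend]
  simp [hH]

end IntegrationByParts

theorem exists_depth_of_forall_reflTransGen {V : Type*} {R : V → V → Prop} {r : V}
    (hR : ∀ v, ReflTransGen R r v) :
    ∃ d : V → ℕ, ∀ v ≠ r, ∃ u, R u v ∧ d u < d v := by
  let _ : Quiver V := ⟨fun u v => PLift (R u v)⟩
  have : Quiver.RootedConnected r := ⟨fun v => by
    induction hR v with
    | refl => exact ⟨.nil⟩
    | tail _ huv ih => exact ih.map (·.cons ⟨huv⟩)⟩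
  refine ⟨fun v => (Quiver.shortestPath r v).length, fun v hv => ?_⟩
  cases hpath : Quiver.shortestPath r v with
  | nil => exact absurd rfl hv
  | @cons u _ path huv =>
    exact ⟨u, huv.down, by simpa [hpath, Nat.lt_succ_iff] using Quiver.shortest_path_spec r path⟩

section Digraph

variable {V : Type*} {r : V} {w : V → V → ℝ}

theorem exists_strict_superharmonic [Fintype V] (hw : ∀ i j, 0 ≤ w i j)
    (hr : ∀ v, ReflTransGen (fun u v => 0 < w v u) r v) :
    ∃ p : V → ℝ, (∀ i, 1 ≤ p i ∧ p i ≤ 2) ∧ ∀ i ≠ r, 0 < ∑ j, w i j * (p i - p j) := by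
  obtain ⟨d, hd⟩ := exists_depth_of_forall_reflTransGen hr
  choose! u hu hdu using hd
  obtain ⟨δ, hδ, hδpos, hδle⟩ :
      ∃ δ : ℝ, (∀ i ≠ r, (∑ j, w i j) * δ < w i (u i)) ∧ 0 < δ ∧ δ ≤ 1 := by
    have hsmall : ∀ i ≠ r, ∀ᶠ δ : ℝ in 𝓝[>] 0, (∑ j, w i j) * δ < w i (u i) := fun i hi =>
      ((continuous_const_mul (∑ j, w i j)).tendsto' 0 0 (mul_zero _)).mono_left
        nhdsWithin_le_nhds |>.eventually_lt_const (hu i hi)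
    refine ((eventually_all.2 fun i => eventually_all.2 (hsmall i)).and
      (Ioc_mem_nhdsGT one_pos)).exists
  refine ⟨fun i => 2 - δ ^ d i, fun i => ?_, fun i hi => ?_⟩
  · have hle : δ ^ d i ≤ 1 := pow_le_one₀ hδpos.le hδle
    have hpos : 0 < δ ^ d i := pow_pos hδpos _
    constructor <;> linarith
  · have hparent : w i (u i) * δ ^ (d i - 1) ≤ ∑ j, w i j * δ ^ d j :=
      calc w i (u i) * δ ^ (d i - 1) ≤ w i (u i) * δ ^ d (u i) := by
            gcongr ?_ * ?_
            · exact hw _ _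
            · exact pow_le_pow_of_le_one hδpos.le hδle (Nat.le_sub_one_of_lt (hdu i hi))
        _ ≤ ∑ j, w i j * δ ^ d j :=
            Finset.single_le_sum (f := fun j => w i j * δ ^ d j)
              (fun j _ => mul_nonneg (hw i j) (pow_pos hδpos _).le) (Finset.mem_univ (u i))
    calc 0 < (w i (u i) - (∑ j, w i j) * δ) * δ ^ (d i - 1) :=
          mul_pos (sub_pos.2 (hδ i hi)) (pow_pos hδpos _)
      _ = w i (u i) * δ ^ (d i - 1) - (∑ j, w i j) * δ ^ d i := by
          rw [sub_mul, mul_assoc, mul_pow_sub_one (Nat.ne_zero_of_lt (hdu i hi))]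
      _ ≤ ∑ j, w i j * δ ^ d j - (∑ j, w i j) * δ ^ d i := by gcongr
      _ = ∑ j, w i j * ((2 - δ ^ d i) - (2 - δ ^ d j)) := by
          rw [Finset.sum_mul, ← Finset.sum_sub_distrib]
          exact Finset.sum_congr rfl fun j _ => by ring

theorem exists_pos_sum_mul_exp_lt_sub_mul [Fintype V] {p : V → ℝ}
    (hp : ∀ i ≠ r, 0 < ∑ j, w i j * (p i - p j)) (T : ℝ) :
    ∃ β > 0, ∀ i ≠ r,
      (∑ j, w i j * p j) * Real.exp (β * T) < (∑ j, w i j - β) * p i := by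
  have hnear : ∀ i ≠ r, ∀ᶠ β : ℝ in 𝓝[>] 0,
      (∑ j, w i j * p j) * Real.exp (β * T) < (∑ j, w i j - β) * p i := fun i hi => by
    have hlt := hp i hi
    simp only [mul_sub, Finset.sum_sub_distrib, ← Finset.sum_mul] at hlt
    exact nhdsWithin_le_nhds (ContinuousAt.eventually_lt (by fun_prop) (by fun_prop)
      (by simpa using sub_pos.1 hlt))
  obtain ⟨β, hβ, hpos⟩ :=
    ((eventually_all.2 fun i => eventually_all.2 (hnear i)).and self_mem_nhdsWithin).exists
  exact ⟨β, hpos, hβ⟩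

end Digraph

section Comoving

variable {E : Type*} [NormedAddCommGroup E] [NormedSpace ℝ E] [CompleteSpace E] (L : E →L[ℝ] E)

theorem exp_smul_apply_exp_smul_apply (s t : ℝ) (v : E) :
    NormedSpace.exp (s • L) (NormedSpace.exp (t • L) v) = NormedSpace.exp ((s + t) • L) v := by
  let _ : NormedAlgebra ℚ (E →L[ℝ] E) := .restrictScalars ℚ ℝ _
  rw [add_smul, NormedSpace.exp_add_of_commute (((Commute.refl L).smul_left s).smul_right t)]
  rfl

/-- The curve `x` in the coordinates that move with the flow of `x' = L x`: its constant curves are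
the trajectories of that flow. -/
noncomputable def comoving (x : ℝ → E) (t : ℝ) : E :=
  NormedSpace.exp (-t • L) (x t)

theorem exp_smul_comoving (x : ℝ → E) (s t : ℝ) :
    NormedSpace.exp (s • L) (comoving L x t) = NormedSpace.exp ((s - t) • L) (x t) := by
  rw [comoving, exp_smul_apply_exp_smul_apply, sub_eq_add_neg]

theorem hasDerivAt_exp_neg_smul (t : ℝ) :
    HasDerivAt (fun s : ℝ => NormedSpace.exp (-s • L)) (-(NormedSpace.exp (-t • L) * L)) t :=
  ((hasDerivAt_exp_smul_const L (-t)).scomp t (hasDerivAt_neg t)).congr_deriv (neg_one_smul ℝ _)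

theorem continuous_exp_neg_smul : Continuous fun t : ℝ => NormedSpace.exp (-t • L) :=
  continuous_iff_continuousAt.2 fun t => (hasDerivAt_exp_neg_smul L t).continuousAt

variable {L}

theorem continuous_comoving {x : ℝ → E} (hx : Continuous x) : Continuous (comoving L x) :=
  (continuous_exp_neg_smul L).clm_apply hx

theorem comoving_eq_apply_zero {x : ℝ → E} (hx : ∀ t, HasDerivAt x (L (x t)) t) (t : ℝ) :
    comoving L x t = x 0 := by
  have hderiv : ∀ s, HasDerivAt (comoving L x) 0 s := fun s =>
    ((hasDerivAt_exp_neg_smul L s).clm_apply (hx s)).congr_deriv (by simp)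
  rw [is_const_of_deriv_eq_zero (fun s => (hderiv s).differentiableAt) (fun s => (hderiv s).deriv)
    t 0]
  simp [comoving]

theorem exp_smul_apply_sub {x : ℝ → E} (hx : ∀ t, HasDerivAt x (L (x t)) t) (s t : ℝ) :
    NormedSpace.exp (s • L) (x (t - s)) = x t := by
  have hcomoving : comoving L x (t - s) = comoving L x t := by
    rw [comoving_eq_apply_zero hx, comoving_eq_apply_zero hx]
  simpa [exp_smul_comoving] using congrArg (fun v => NormedSpace.exp (t • L) v) hcomoving

theorem comoving_eq_add_integral {x h : ℝ → E} {T : ℝ} (hh : IntervalIntegrable h volume 0 T)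
    (hx : ∀ t ∈ uIcc 0 T, x t = x 0 + ∫ s in (0 : ℝ)..t, h s) :
    comoving L x T = x 0 + ∫ s in (0 : ℝ)..T, NormedSpace.exp (-s • L) (h s - L (x s)) := by
  have hparts := clm_apply_sub_eq_integral_of_hasDerivAt (hasDerivAt_exp_neg_smul L)
    (((continuous_exp_neg_smul L).mul continuous_const).neg) hh hx
  have hintegrand : ∀ s, (-(NormedSpace.exp (-s • L) * L)) (x s) + NormedSpace.exp (-s • L) (h s) =
      NormedSpace.exp (-s • L) (h s - L (x s)) := fun s => by
    rw [map_sub, neg_apply, mul_apply_eq_comp, neg_add_eq_sub]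
  simp only [hintegrand] at hparts
  rw [← hparts]
  simp [comoving]

end Comoving

theorem le_of_forall_past_le_imp_lt {ι : Type*} [Finite ι] {φ : ι → ℝ → ℝ} {K : ℝ}
    (hcont : ∀ i, ContinuousOn (φ i) (Ici 0)) (hinit : ∀ i, ∀ t ≤ 0, φ i t ≤ K)
    (hstep : ∀ M > K, ∀ T ≥ 0, (∀ j, ∀ t ≤ T, φ j t ≤ M) → ∀ i, φ i T < M) (i : ι) (t : ℝ) :
    φ i t ≤ K := by
  rcases le_total t 0 with ht | ht
  · exact hinit i t ht
  have : Nonempty ι := ⟨i⟩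
  choose s hs hmax using fun j => isCompact_Icc.exists_isMaxOn (nonempty_Icc.2 ht)
    ((hcont j).mono Icc_subset_Ici_self)
  obtain ⟨k, hk⟩ := Finite.exists_max fun j => φ j (s j)
  have hle : ∀ j, ∀ r ∈ Icc 0 t, φ j r ≤ φ k (s k) := fun j r hr => (hmax j hr).trans (hk j)
  refine (hle i t ⟨ht, le_rfl⟩).trans (not_lt.1 fun hlt => ?_)
  refine (hstep _ hlt (s k) (hs k).1 (fun j r hr => ?_) k).false
  rcases le_total r 0 with hr0 | hr0
  · exact (hinit j r hr0).trans hlt.le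
  · exact hle j r ⟨hr0, hr.trans (hs k).2⟩

section DelayedConsensus

variable {V E : Type*} [Fintype V] [NormedAddCommGroup E] [NormedSpace ℝ E]
  {L : E →L[ℝ] E} {w : V → V → ℝ} {τ : V → V → ℝ → ℝ} {r : V} {e : V → ℝ → E}

/-- The right-hand side of the delayed consensus dynamics at the node `i`, with coupling gains `w`
and delays `τ i j` from `j` to `i`. A delayed value is first transported to the present time by the
flow of `x' = L x`. -/
noncomputable def consensusField (L : E →L[ℝ] E) (w : V → V → ℝ) (τ : V → V → ℝ → ℝ)
    (e : V → ℝ → E) (i : V) (t : ℝ) : E :=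
  L (e i t) + ∑ j, w i j • (NormedSpace.exp (τ i j t • L) (e j (t - τ i j t)) - e i t)

/-- A Carathéodory solution on `[0, ∞)` of the delayed consensus dynamics at all nodes other than
`r`, the node `r` being held at `0`. The values at negative times are the initial history. -/
structure IsPinnedConsensus (L : E →L[ℝ] E) (w : V → V → ℝ) (τ : V → V → ℝ → ℝ) (r : V)
    (e : V → ℝ → E) : Prop where
  continuous : ∀ i, Continuous (e i)
  eq_zero : ∀ t, e r t = 0
  integrable : ∀ i ≠ r, ∀ t ≥ 0, IntervalIntegrable (consensusField L w τ e i) volume 0 t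
  eq_add_integral : ∀ i ≠ r, ∀ t ≥ 0,
    e i t = e i 0 + ∫ s in (0 : ℝ)..t, consensusField L w τ e i s

theorem consensusField_eq (i : V) (t : ℝ) :
    consensusField L w τ e i t = (L - (∑ j, w i j) • 1) (e i t) +
      ∑ j, w i j • NormedSpace.exp (τ i j t • L) (e j (t - τ i j t)) := by
  simp only [consensusField, smul_sub, Finset.sum_sub_distrib, ← Finset.sum_smul, sub_apply,
    smul_apply, one_apply_eq_self]
  abel

theorem norm_sum_smul_delayed_le {p : V → ℝ} {β T M s : ℝ} {i : V} (hw : ∀ j, 0 ≤ w i j)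
    (hp : ∀ j, 0 ≤ p j) (hβ : 0 ≤ β) (hM : 0 ≤ M)
    (hτ : ∀ j, 0 < w i j → 0 ≤ τ i j s ∧ τ i j s ≤ T) {z : V → ℝ → E}
    (hz : ∀ j, ∀ t ≤ s, ‖z j t‖ ≤ M * p j * Real.exp (-β * t)) :
    ‖∑ j, w i j • z j (s - τ i j s)‖ ≤
      M * ((∑ j, w i j * p j) * Real.exp (β * T)) * Real.exp (-β * s) := by
  have hterm : ∀ j, ‖w i j • z j (s - τ i j s)‖ ≤
      M * (w i j * p j * Real.exp (β * T)) * Real.exp (-β * s) := fun j => by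
    rcases (hw j).eq_or_lt with h0 | hpos
    · simp [← h0]
    obtain ⟨hτ0, hτT⟩ := hτ j hpos
    calc ‖w i j • z j (s - τ i j s)‖
        = w i j * ‖z j (s - τ i j s)‖ := norm_smul_of_nonneg (hw j) _
      _ ≤ w i j * (M * p j * Real.exp (-β * (s - T))) := by
          refine mul_le_mul_of_nonneg_left ((hz j _ (by linarith)).trans ?_) (hw j)
          have hMp := mul_nonneg hM (hp j)
          gcongr ?_ * Real.exp ?_
          nlinarith
      _ = M * (w i j * p j * Real.exp (β * T)) * Real.exp (-β * s) := by
          rw [show -β * (s - T) = β * T + -β * s by ring, Real.exp_add]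
          ring
  calc ‖∑ j, w i j • z j (s - τ i j s)‖
      ≤ ∑ j, M * (w i j * p j * Real.exp (β * T)) * Real.exp (-β * s) :=
        norm_sum_le_of_le _ fun j _ => hterm j
    _ = M * ((∑ j, w i j * p j) * Real.exp (β * T)) * Real.exp (-β * s) := by
        rw [← Finset.sum_mul, ← Finset.mul_sum, ← Finset.sum_mul]

theorem norm_lt_of_variation_of_constants {d β M p T : ℝ} {x : ℝ → E} {x₀ : E} {g : ℝ → E}
    (hT : 0 ≤ T)
    (hx : Real.exp (d * T) • x T = x₀ + ∫ s in (0 : ℝ)..T, Real.exp (d * s) • g s)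
    (hx₀ : ‖x₀‖ < M * p)
    (hg : ∀ s ∈ Icc 0 T, ‖g s‖ ≤ M * ((d - β) * p) * Real.exp (-β * s)) :
    ‖x T‖ < M * p * Real.exp (-β * T) := by
  have hderiv : ∀ s, HasDerivAt (fun s => M * p * Real.exp ((d - β) * s))
      (M * ((d - β) * p) * Real.exp ((d - β) * s)) s := fun s => by
    refine ((((hasDerivAt_id s).const_mul (d - β)).exp).const_mul (M * p)).congr_deriv ?_
    simp only [id_eq]
    ring
  have hint : IntervalIntegrable (fun s => M * ((d - β) * p) * Real.exp ((d - β) * s)) volume 0 T :=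
    Continuous.intervalIntegrable (by fun_prop) _ _
  have hforcing : ‖∫ s in (0 : ℝ)..T, Real.exp (d * s) • g s‖ ≤
      M * p * Real.exp ((d - β) * T) - M * p := by
    calc ‖∫ s in (0 : ℝ)..T, Real.exp (d * s) • g s‖
        ≤ ∫ s in (0 : ℝ)..T, M * ((d - β) * p) * Real.exp ((d - β) * s) := by
          refine intervalIntegral.norm_integral_le_of_norm_le hT (.of_forall fun s hs => ?_) hint
          rw [norm_smul_of_nonneg (Real.exp_pos _).le,
            show (d - β) * s = d * s + -β * s by ring, Real.exp_add, mul_left_comm]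
          gcongr
          exact hg s (Ioc_subset_Icc_self hs)
      _ = M * p * Real.exp ((d - β) * T) - M * p := by
          rw [intervalIntegral.integral_eq_sub_of_hasDerivAt (fun s _ => hderiv s) hint]
          simp
  have hexp : Real.exp (d * T) * ‖x T‖ < Real.exp (d * T) * (M * p * Real.exp (-β * T)) := by
    calc Real.exp (d * T) * ‖x T‖
        = ‖x₀ + ∫ s in (0 : ℝ)..T, Real.exp (d * s) • g s‖ := by
          rw [← hx, norm_smul_of_nonneg (Real.exp_pos _).le]
      _ < M * p + (M * p * Real.exp ((d - β) * T) - M * p) :=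
          (norm_add_le _ _).trans_lt (add_lt_add_of_lt_of_le hx₀ hforcing)
      _ = Real.exp (d * T) * (M * p * Real.exp (-β * T)) := by
          rw [add_sub_cancel, mul_left_comm, ← Real.exp_add]
          ring_nf
  exact lt_of_mul_lt_mul_left hexp (Real.exp_pos _).le

variable [CompleteSpace E]

theorem exp_neg_smul_sub_smul_one (c t : ℝ) :
    NormedSpace.exp (-t • (L - c • 1)) = Real.exp (c * t) • NormedSpace.exp (-t • L) := by
  rw [exp_eq_exp_smul_exp_sub (𝕜 := ℝ) (-t • (L - c • 1)) (c * t), Real.exp_eq_exp_ℝ]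
  congr 2
  module

theorem IsPinnedConsensus.exp_smul_comoving_eq (he : IsPinnedConsensus L w τ r e) {i : V}
    (hi : i ≠ r) {T : ℝ} (hT : 0 ≤ T) :
    Real.exp ((∑ j, w i j) * T) • comoving L (e i) T =
      e i 0 + ∫ s in (0 : ℝ)..T,
        Real.exp ((∑ j, w i j) * s) • ∑ j, w i j • comoving L (e j) (s - τ i j s) := by
  have hvar := comoving_eq_add_integral (L := L - (∑ j, w i j) • 1) (he.integrable i hi T hT)
    fun t ht => he.eq_add_integral i hi t (uIcc_of_le hT ▸ ht).1
  simp only [comoving, consensusField_eq, add_sub_cancel_left, exp_neg_smul_sub_smul_one,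
    smul_apply, map_sum, map_smul, exp_smul_apply_exp_smul_apply] at hvar ⊢
  simpa only [neg_sub, neg_add_eq_sub, smul_comm (w i _) (Real.exp _), ← Finset.smul_sum]
    using hvar

theorem IsPinnedConsensus.norm_comoving_le (he : IsPinnedConsensus L w τ r e) {p : V → ℝ}
    {β T K : ℝ} (hw : ∀ i j, 0 ≤ w i j)
    (hτ : ∀ i ≠ r, ∀ j, 0 < w i j → ∀ t ≥ 0, 0 ≤ τ i j t ∧ τ i j t ≤ T)
    (hp : ∀ i, 1 ≤ p i) (hβ : 0 ≤ β)
    (hrate : ∀ i ≠ r, (∑ j, w i j * p j) * Real.exp (β * T) ≤ (∑ j, w i j - β) * p i)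
    (hK : ∀ i, ∀ t ≤ 0, ‖comoving L (e i) t‖ ≤ K) (i : V) (t : ℝ) :
    ‖comoving L (e i) t‖ ≤ K * p i * Real.exp (-β * t) := by
  have hK0 : 0 ≤ K := (norm_nonneg _).trans (hK r 0 le_rfl)
  have hppos : ∀ j, 0 < p j := fun j => zero_lt_one.trans_le (hp j)
  have hpos : ∀ j s, 0 < p j * Real.exp (-β * s) := fun j s =>
    mul_pos (hppos j) (Real.exp_pos _)
  rw [mul_assoc, ← div_le_iff₀ (hpos i t)]
  refine le_of_forall_past_le_imp_lt
    (φ := fun j s => ‖comoving L (e j) s‖ / (p j * Real.exp (-β * s)))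
    (fun j => ?_) (fun j s hs => ?_) (fun M hM S hS hpast j => ?_) i t
  · exact ((continuous_comoving (he.continuous j)).norm.div (by fun_prop)
      fun s => (hpos j s).ne').continuousOn
  · have hone : 1 ≤ p j * Real.exp (-β * s) :=
      one_le_mul_of_one_le_of_one_le (hp j)
        (Real.one_le_exp (mul_nonneg_of_nonpos_of_nonpos (neg_nonpos.2 hβ) hs))
    exact (div_le_self (norm_nonneg _) hone).trans (hK j s hs)
  have hM0 : 0 < M := hK0.trans_lt hM
  rcases eq_or_ne j r with rfl | hj
  · simpa [comoving, he.eq_zero] using hM0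
  simp only [div_le_iff₀ (hpos _ _), ← mul_assoc] at hpast
  rw [div_lt_iff₀ (hpos j S), ← mul_assoc]
  refine norm_lt_of_variation_of_constants hS (he.exp_smul_comoving_eq hj hS) ?_ fun s hs => ?_
  · calc ‖e j 0‖ = ‖comoving L (e j) 0‖ := by simp [comoving]
      _ ≤ K := hK j 0 le_rfl
      _ < M := hM
      _ ≤ M * p j := le_mul_of_one_le_right hM0.le (hp j)
  · refine (norm_sum_smul_delayed_le (hw j) (fun k => (hppos k).le) hβ hM0.le
      (fun k hk => hτ j hj k hk s hs.1) fun k t ht => hpast k t (ht.trans hs.2)).trans ?_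
    gcongr M * ?_ * _
    exact hrate j hj

theorem exists_norm_comoving_le_of_isPinnedConsensus (hw : ∀ i j, 0 ≤ w i j)
    (hr : ∀ i, ReflTransGen (fun j i => 0 < w i j) r i) {T : ℝ}
    (hτ : ∀ i ≠ r, ∀ j, 0 < w i j → ∀ t ≥ 0, 0 ≤ τ i j t ∧ τ i j t ≤ T) :
    ∃ β > 0, ∀ (L : E →L[ℝ] E) (e : V → ℝ → E), IsPinnedConsensus L w τ r e →
      ∀ K, (∀ i, ∀ t ≤ 0, ‖comoving L (e i) t‖ ≤ K) →
        ∀ i t, ‖comoving L (e i) t‖ ≤ 2 * K * Real.exp (-β * t) := by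
  obtain ⟨p, hp, hsuper⟩ := exists_strict_superharmonic hw hr
  obtain ⟨β, hβ, hrate⟩ := exists_pos_sum_mul_exp_lt_sub_mul hsuper T
  refine ⟨β, hβ, fun L e he K hK i t => ?_⟩
  have hK0 : 0 ≤ K := (norm_nonneg _).trans (hK r 0 le_rfl)
  calc ‖comoving L (e i) t‖ ≤ K * p i * Real.exp (-β * t) :=
        he.norm_comoving_le hw hτ (fun j => (hp j).1) hβ.le (fun j hj => (hrate j hj).le) hK i t
    _ ≤ K * 2 * Real.exp (-β * t) := by
        gcongr
        exact (hp i).2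
    _ = 2 * K * Real.exp (-β * t) := by rw [mul_comm K]

theorem exists_norm_le_of_isPinnedConsensus (hw : ∀ i j, 0 ≤ w i j)
    (hr : ∀ i, ReflTransGen (fun j i => 0 < w i j) r i) {T : ℝ}
    (hτ : ∀ i ≠ r, ∀ j, 0 < w i j → ∀ t ≥ 0, 0 ≤ τ i j t ∧ τ i j t ≤ T)
    (hL : ∀ b > 0, ∃ C : ℝ, ∀ t ≥ 0, ‖NormedSpace.exp (t • L)‖ ≤ C * Real.exp (b * t)) :
    ∃ C > 0, ∃ β > 0, ∀ e : V → ℝ → E, IsPinnedConsensus L w τ r e →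
      ∀ K, (∀ i, ∀ t ≤ 0, ‖comoving L (e i) t‖ ≤ K) →
        ∀ i, ∀ t ≥ 0, ‖e i t‖ ≤ C * Real.exp (-β * t) * K := by
  obtain ⟨β, hβ, hdecay⟩ := exists_norm_comoving_le_of_isPinnedConsensus (E := E) hw hr hτ
  obtain ⟨C, hC⟩ := hL (β / 2) (half_pos hβ)
  refine ⟨2 * max C 1, by positivity, β / 2, half_pos hβ, fun e he K hK i t ht => ?_⟩
  calc ‖e i t‖ = ‖NormedSpace.exp (t • L) (comoving L (e i) t)‖ := by
        simp [exp_smul_comoving]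
    _ ≤ ‖NormedSpace.exp (t • L)‖ * ‖comoving L (e i) t‖ := ContinuousLinearMap.le_opNorm _ _
    _ ≤ (max C 1 * Real.exp (β / 2 * t)) * (2 * K * Real.exp (-β * t)) := by
        gcongr
        · exact (hC t ht).trans (by gcongr; exact le_max_left _ _)
        · exact hdecay L e he K hK i t
    _ = 2 * max C 1 * (Real.exp (β / 2 * t) * Real.exp (-β * t)) * K := by ring
    _ = 2 * max C 1 * Real.exp (-(β / 2) * t) * K := by
        rw [← Real.exp_add]
        ring_nf

end DelayedConsensus

section Observer

variable {N n : ℕ} {A : Matrix (Fin n) (Fin n) ℝ} {G : Digraph (Fin (N + 1))} {ε : ℝ}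
  {τ : Fin (N + 1) → Fin (N + 1) → ℝ → ℝ} {x₀ : ℝ → Fin n → ℝ} {ξ : Fin N → ℝ → Fin n → ℝ}

/-- The gain with which the observer of agent `i` is coupled to agent `j`. Self-loops of the
communication digraph do not enter the observer equations, so their gain is `0`. -/
noncomputable def couplingGain (G : Digraph (Fin (N + 1))) (ε : ℝ) (i j : Fin (N + 1)) : ℝ :=
  if i = j then 0 else ε * weight G i j

/-- The deviations from the leader of all agents, the leader itself included as agent `0`. -/
noncomputable def observerError (x₀ : ℝ → Fin n → ℝ) (ξ : Fin N → ℝ → Fin n → ℝ)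
    (i : Fin (N + 1)) (t : ℝ) : EuclideanSpace ℝ (Fin n) :=
  WithLp.toLp 2 ((Fin.cons x₀ ξ : Fin (N + 1) → ℝ → Fin n → ℝ) i t - x₀ t)

theorem couplingGain_nonneg (hε : 0 < ε) (i j : Fin (N + 1)) : 0 ≤ couplingGain G ε i j := by
  unfold couplingGain weight
  split_ifs <;> simp [hε.le]

theorem couplingGain_pos_iff (hε : 0 < ε) {i j : Fin (N + 1)} :
    0 < couplingGain G ε i j ↔ i ≠ j ∧ G.Adj j i := by
  unfold couplingGain weight
  split_ifs <;> simp_all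

theorem HasSpanningTreeRootedAt.reflTransGen_couplingGain_pos {r : Fin (N + 1)}
    (hG : HasSpanningTreeRootedAt G r) (hε : 0 < ε) (i : Fin (N + 1)) :
    ReflTransGen (fun j i => 0 < couplingGain G ε i j) r i := by
  induction hG i with
  | refl => exact .refl
  | @tail j i _ hji ih =>
    rcases eq_or_ne i j with rfl | hne
    · exact ih
    · exact ih.tail ((couplingGain_pos_iff hε).2 ⟨hne, hji⟩)

theorem IsLeaderTrajectory.hasDerivAt_toLp (hx₀ : IsLeaderTrajectory A x₀) (t : ℝ) :
    HasDerivAt (fun t => WithLp.toLp 2 (x₀ t))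
      (Matrix.toEuclideanCLM (n := Fin n) (𝕜 := ℝ) A (WithLp.toLp 2 (x₀ t))) t :=
  ((PiLp.continuousLinearEquiv 2 ℝ fun _ : Fin n => ℝ).symm.hasFDerivAt.comp_hasDerivAt t
    (hx₀ t) :)

theorem exp_smul_toEuclideanCLM_toLp (A : Matrix (Fin n) (Fin n) ℝ) (s : ℝ) (v : Fin n → ℝ) :
    NormedSpace.exp (s • Matrix.toEuclideanCLM (n := Fin n) (𝕜 := ℝ) A) (WithLp.toLp 2 v) =
      WithLp.toLp 2 (NormedSpace.exp (s • A) *ᵥ v) := by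
  rw [← map_smul, ← toEuclideanCLM_exp, Matrix.toEuclideanCLM_toLp]

theorem IsLeaderTrajectory.exp_smul_mulVec_sub (hx₀ : IsLeaderTrajectory A x₀) (s t : ℝ) :
    NormedSpace.exp (s • A) *ᵥ x₀ (t - s) = x₀ t := by
  have h := exp_smul_apply_sub hx₀.hasDerivAt_toLp s t
  rw [exp_smul_toEuclideanCLM_toLp] at h
  exact WithLp.toLp_injective 2 h

theorem observerField_eq_sum_couplingGain (i : Fin N) (t : ℝ) :
    observerField A G ε τ x₀ ξ i t = A *ᵥ ξ i t + ∑ j, couplingGain G ε i.succ j •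
      (NormedSpace.exp (τ i.succ j t • A) *ᵥ
        (Fin.cons x₀ ξ : Fin (N + 1) → ℝ → Fin n → ℝ) j (t - τ i.succ j t) - ξ i t) := by
  have hself : couplingGain G ε i.succ i.succ = 0 := if_pos rfl
  have hne : ∀ j ∈ Finset.univ.erase i,
      couplingGain G ε i.succ j.succ = ε * weight G i.succ j.succ := fun j hj =>
    if_neg ((Fin.succ_injective N).ne (Finset.ne_of_mem_erase hj).symm)
  have hzero : couplingGain G ε i.succ 0 = ε * weight G i.succ 0 := if_neg (Fin.succ_ne_zero i)
  rw [observerField, Fin.sum_univ_succ, ← Finset.add_sum_erase _ _ (Finset.mem_univ i),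
    hself, hzero, Finset.smul_sum, zero_smul, zero_add, add_assoc, add_comm (Finset.sum _ _)]
  simp only [Fin.cons_zero, Fin.cons_succ]
  congr 2
  exact Finset.sum_congr rfl fun j hj => by rw [hne j hj, mul_smul]

theorem IsLeaderTrajectory.consensusField_observerError (hx₀ : IsLeaderTrajectory A x₀)
    (i : Fin N) (t : ℝ) :
    consensusField (Matrix.toEuclideanCLM (n := Fin n) (𝕜 := ℝ) A) (couplingGain G ε) τ
        (observerError x₀ ξ) i.succ t =
      WithLp.toLp 2 (observerField A G ε τ x₀ ξ i t - A *ᵥ x₀ t) := by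
  simp only [consensusField, observerError, exp_smul_toEuclideanCLM_toLp,
    Matrix.toEuclideanCLM_toLp, Matrix.mulVec_sub, hx₀.exp_smul_mulVec_sub, Fin.cons_succ,
    ← WithLp.toLp_sub, ← WithLp.toLp_smul, ← WithLp.toLp_sum, ← WithLp.toLp_add,
    sub_sub_sub_cancel_right, observerField_eq_sum_couplingGain]
  rw [sub_add_eq_add_sub]

theorem IsLeaderTrajectory.continuous (hx₀ : IsLeaderTrajectory A x₀) : Continuous x₀ :=
  continuous_iff_continuousAt.2 fun t => (hx₀ t).continuousAt

theorem IsLeaderTrajectory.intervalIntegrable_mulVec (hx₀ : IsLeaderTrajectory A x₀) (a b : ℝ) :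
    IntervalIntegrable (fun s => A *ᵥ x₀ s) volume a b :=
  (continuous_const.matrix_mulVec hx₀.continuous).intervalIntegrable a b

theorem IsLeaderTrajectory.observerError_eq_add_integral (hx₀ : IsLeaderTrajectory A x₀)
    (hξ : IsObserverTrajectory A G ε τ x₀ ξ) (i : Fin N) {t : ℝ} (ht : 0 ≤ t) :
    ξ i t - x₀ t = (ξ i 0 - x₀ 0) +
      ∫ s in (0 : ℝ)..t, (observerField A G ε τ x₀ ξ i s - A *ᵥ x₀ s) := by
  rw [intervalIntegral.integral_sub (hξ.integrable i t ht) (hx₀.intervalIntegrable_mulVec 0 t),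
    intervalIntegral.integral_eq_sub_of_hasDerivAt (fun s _ => hx₀ s)
      (hx₀.intervalIntegrable_mulVec 0 t), ← hξ.eq_integral i t ht, hξ.eq_zero i 0 le_rfl]
  abel

theorem IsObserverTrajectory.isPinnedConsensus (hξ : IsObserverTrajectory A G ε τ x₀ ξ)
    (hx₀ : IsLeaderTrajectory A x₀) :
    IsPinnedConsensus (Matrix.toEuclideanCLM (n := Fin n) (𝕜 := ℝ) A) (couplingGain G ε) τ 0
      (observerError x₀ ξ) := by
  let T := (PiLp.continuousLinearEquiv 2 ℝ fun _ : Fin n => ℝ).symm.toContinuousLinearMap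
  have hint : ∀ i : Fin N, ∀ t ≥ 0, IntervalIntegrable
      (fun s => observerField A G ε τ x₀ ξ i s - A *ᵥ x₀ s) volume 0 t := fun i t ht =>
    (hξ.integrable i t ht).sub (hx₀.intervalIntegrable_mulVec 0 t)
  refine ⟨fun i => ?_, fun t => by simp [observerError], fun i hi t ht => ?_, fun i hi t ht => ?_⟩
  · refine T.continuous.comp (.sub ?_ hx₀.continuous)
    cases i using Fin.cases with
    | zero => exact hx₀.continuous
    | succ i => exact hξ.continuous i
  all_goals
    obtain ⟨i, rfl⟩ := Fin.exists_succ_eq.2 hi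
    simp only [hx₀.consensusField_observerError, funext (hx₀.consensusField_observerError i)]
  · exact ⟨T.integrable_comp (hint i t ht).1, T.integrable_comp (hint i t ht).2⟩
  · have h := congrArg T (hx₀.observerError_eq_add_integral hξ i ht)
    rwa [map_add, ← T.intervalIntegral_comp_comm (hint i t ht)] at h

theorem IsObserverTrajectory.norm_comoving_observerError_le
    (hξ : IsObserverTrajectory A G ε τ x₀ ξ) (hx₀ : IsLeaderTrajectory A x₀) (i : Fin (N + 1))
    {t : ℝ} (ht : t ≤ 0) :
    ‖comoving (Matrix.toEuclideanCLM (n := Fin n) (𝕜 := ℝ) A) (observerError x₀ ξ i) t‖ ≤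
      ‖WithLp.toLp 2 (x₀ 0)‖ := by
  cases i using Fin.cases with
  | zero => simp [comoving, observerError]
  | succ i =>
    have herror : observerError x₀ ξ i.succ t = -WithLp.toLp 2 (x₀ t) := by
      simp [observerError, hξ.eq_zero i t ht]
    have hleader := comoving_eq_apply_zero hx₀.hasDerivAt_toLp t
    rw [comoving] at hleader
    rw [comoving, herror, map_neg, norm_neg, hleader]

end Observer

theorem lemma1 {N n : ℕ} (A : Matrix (Fin n) (Fin n) ℝ) (hA : NoEigenvalueWithPosRe A)
    (G : Digraph (Fin (N + 1))) (hG : HasSpanningTreeRootedAt G 0)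
    (ε : ℝ) (hε : 0 < ε)
    (τ : Fin (N + 1) → Fin (N + 1) → ℝ → ℝ) (τbar : ℝ)
    (hτ : ∀ (i : Fin N) (j : Fin (N + 1)), G.Adj j i.succ →
      ∀ t ≥ 0, 0 ≤ τ i.succ j t ∧ τ i.succ j t ≤ τbar) :
    ∃ C > 0, ∃ β > 0, ∀ (x₀ : ℝ → Fin n → ℝ) (ξ : Fin N → ℝ → Fin n → ℝ),
      IsLeaderTrajectory A x₀ → IsObserverTrajectory A G ε τ x₀ ξ →
        ∀ (i : Fin N), ∀ t ≥ 0,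
          ‖WithLp.toLp 2 (ξ i t - x₀ t)‖ ≤ C * Real.exp (-β * t) * ‖WithLp.toLp 2 (x₀ 0)‖ := by
  have hdelay : ∀ i ≠ 0, ∀ j, 0 < couplingGain G ε i j → ∀ t ≥ 0, 0 ≤ τ i j t ∧ τ i j t ≤ τbar := by
    intro i hi j hij
    obtain ⟨i, rfl⟩ := Fin.exists_succ_eq.2 hi
    exact hτ i j ((couplingGain_pos_iff hε).1 hij).2
  obtain ⟨C, hC, β, hβ, hdecay⟩ := exists_norm_le_of_isPinnedConsensus (couplingGain_nonneg hε)
    (hG.reflTransGen_couplingGain_pos hε) hdelay fun b hb => hA.exists_norm_exp_smul_le hb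
  exact ⟨C, hC, β, hβ, fun x₀ ξ hx₀ hξ i => hdecay _ (hξ.isPinnedConsensus hx₀) _
    (fun j t ht => hξ.norm_comoving_observerError_le hx₀ j ht) i.succ⟩
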